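/- Let $k$ be a field of characteristic $0$ and $K=k[[h]]$. Let $A_0$ be a (left) noetherian associative unital $k$-algebra and let $A_h$ be a deformation of $A_0$: an associative unital $K$-algebra that is topologically free as a $K$-module (isomorphic to $V[[h]]$ for some $k$-vector space $V$), together with an isomorphism of $k$-algebras $A_h/hA_h\simeq A_0$. Assume that $k$ is endowed with a left $A_0$-module structure (extending its $k$-vector space structure) for which there is an integer $d$ with $$\mathrm{Ext}^i_{A_0}(k,A_0)=0\ \text{ for } i\neq d,\qquad \mathrm{Ext}^d_{A_0}(k,A_0)\simeq k .$$ Assume that $K$ is endowed with a left $A_h$-module structure (extending its $K$-module structure) that reduces modulo $h$ to the given $A_0$-module structure on $k$, and that the $A_h$-module $K$ has finite projective dimension. Let $\Omega_{A_h}=\mathrm{Ext}^d_{A_h}(K,A_h)$, regarded as a right $A_h$-module by right multiplication on $A_h$. For a right $A_h$-module $N$ let $\mathrm{Tor}^{A_h}_j(N,-)$ be the $j$-th left derived functor of $N\otimes_{A_h}-$; $\mathrm{Ext}$ and $\mathrm{Tor}$ in negative degrees are zero. Then for every left $A_h$-module $M$ and every integer $i$ there is an isomorphism of $K$-modules $$\mathrm{Ext}^i_{A_h}(K,M)\;\simeq\;\mathrm{Tor}^{A_h}_{d-i}(\Omega_{A_h},M).$$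 -/

import Mathlib

universe u v

open CategoryTheory

open scoped PowerSeries TensorProduct

noncomputable section

namespace QuantumDuality

section FormalPowerSeries

/-- A `k⟦h⟧`-module `M` is topologically free if it is isomorphic to `V⟦h⟧` for some `k`-vector
space `V`.  Here `V⟦h⟧` is the additive group `ℕ → V` of sequences of coefficients, on which
`k⟦h⟧` acts by `(f • v) n = ∑_{i + j = n} fᵢ • vⱼ`; the isomorphism is `e`. -/
def IsTopologicallyFree (k : Type u) [Field k] (M : Type v) [AddCommGroup M] [Module k⟦X⟧ M] :
    Prop :=
  ∃ (V : Type v) (_ : AddCommGroup V) (_ : Module k V) (e : M ≃+ (ℕ → V)),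
    ∀ (f : k⟦X⟧) (m : M) (n : ℕ),
      e (f • m) n = ∑ p ∈ Finset.HasAntidiagonal.antidiagonal n, PowerSeries.coeff p.1 f • e m p.2

/-- `Deformation k A₀ A` is the structure of a deformation of the `k`-algebra `A₀` on the
`k⟦h⟧`-algebra `A`: the `k⟦h⟧`-module `A` is topologically free and there is an isomorphism of
`k`-algebras `A / hA ≃ A₀`, given as a surjective ring homomorphism `A → A₀` with kernel `hA`
which is compatible with `k⟦h⟧ → k`. -/
structure Deformation (k : Type u) [Field k] (A₀ : Type u) [Ring A₀] [Algebra k A₀]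
    (A : Type u) [Ring A] [Algebra k⟦X⟧ A] where
  isTopologicallyFree : IsTopologicallyFree k A
  /-- The reduction modulo `h`. -/
  red : A →+* A₀
  red_surjective : Function.Surjective red
  red_eq_zero_iff : ∀ a : A, red a = 0 ↔ ∃ b : A, a = (PowerSeries.X : k⟦X⟧) • b
  red_algebraMap : ∀ f : k⟦X⟧,
    red (algebraMap k⟦X⟧ A f) = algebraMap k A₀ (PowerSeries.constantCoeff f)

end FormalPowerSeries

section LinearStructure

variable (R : Type u) [CommRing R] {A : Type u} [Ring A] [Algebra R A]

/-- A module over an `R`-algebra is an `R`-module. -/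
@[reducible]
def moduleOfAlgebra (M : ModuleCat.{u} A) : Module R M :=
  Module.compHom M (algebraMap R A)

attribute [local instance] moduleOfAlgebra

theorem algebraMap_smul_def (M : ModuleCat.{u} A) (r : R) (m : M) :
    r • m = algebraMap R A r • m := rfl

theorem isScalarTower_of_algebra (M : ModuleCat.{u} A) : IsScalarTower R A M where
  smul_assoc r a m := by rw [algebraMap_smul_def, Algebra.smul_def, mul_smul]

attribute [local instance] isScalarTower_of_algebra

theorem smulCommClass_of_algebra (M : ModuleCat.{u} A) : SMulCommClass A R M where
  smul_comm a r m := by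
    rw [algebraMap_smul_def, algebraMap_smul_def, ← mul_smul, ← mul_smul, Algebra.commutes]

attribute [local instance] smulCommClass_of_algebra

/-- For an `R`-algebra `A` the category of `A`-modules is `R`-linear, where `r : R` acts on a
morphism `f` by `(r • f) m = r • f m`.  (Mathlib has this only when `R` is a field.)  This gives the
groups `Ext` over `A` their structure of `R`-modules. -/
instance (priority := 100) linearOfAlgebra : Linear R (ModuleCat.{u} A) where
  homModule _ _ := inferInstance

end LinearStructure

section Tensor

variable (R : Type u) [CommRing R] {A : Type u} [Ring A] [Algebra R A]

attribute [local instance] moduleOfAlgebra isScalarTower_of_algebra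

/-- The submodule of `N ⊗[R] M` generated by the elements `n a ⊗ m - n ⊗ a m`, for a right
`A`-module `N` and a left `A`-module `M`. -/
def balancedSubmodule (N : ModuleCat.{u} Aᵐᵒᵖ) (M : ModuleCat.{u} A) :
    Submodule R (N ⊗[R] M) :=
  Submodule.span R
    {x | ∃ (n : N) (a : A) (m : M), x = (MulOpposite.op a • n) ⊗ₜ[R] m - n ⊗ₜ[R] (a • m)}

/-- The tensor product `N ⊗_A M` of a right `A`-module `N` and a left `A`-module `M` over an
`R`-algebra `A`, as an `R`-module. -/
abbrev BalancedTensor (N : ModuleCat.{u} Aᵐᵒᵖ) (M : ModuleCat.{u} A) : Type u :=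
  (N ⊗[R] M) ⧸ balancedSubmodule R N M

/-- An `A`-linear map, as an `R`-linear map. -/
def restrictHom {M M' : ModuleCat.{u} A} (f : M ⟶ M') : M →ₗ[R] M' where
  toFun := f.hom
  map_add' := map_add f.hom
  map_smul' r m := map_smul f.hom (algebraMap R A r) m

theorem balancedSubmodule_le_comap (N : ModuleCat.{u} Aᵐᵒᵖ) {M M' : ModuleCat.{u} A} (f : M ⟶ M') :
    balancedSubmodule R N M ≤
      (balancedSubmodule R N M').comap (LinearMap.lTensor N (restrictHom R f)) := by
  refine Submodule.span_le.2 ?_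
  rintro _ ⟨n, a, m, rfl⟩
  refine Submodule.subset_span ⟨n, a, f.hom m, ?_⟩
  rw [map_sub, LinearMap.lTensor_tmul, LinearMap.lTensor_tmul]
  exact congrArg (fun y => (MulOpposite.op a • n) ⊗ₜ[R] f.hom m - n ⊗ₜ[R] y) (map_smul f.hom a m)

/-- The map `N ⊗_A M → N ⊗_A M'` induced by a homomorphism `f : M → M'` of left `A`-modules. -/
def balancedMap (N : ModuleCat.{u} Aᵐᵒᵖ) {M M' : ModuleCat.{u} A} (f : M ⟶ M') :
    BalancedTensor R N M →ₗ[R] BalancedTensor R N M' :=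
  Submodule.mapQ _ _ (LinearMap.lTensor N (restrictHom R f)) (balancedSubmodule_le_comap R N f)

/-- The functor `N ⊗_A -` from left `A`-modules to `R`-modules, for a right `A`-module `N`. -/
def tensorFunctor (N : ModuleCat.{u} Aᵐᵒᵖ) : ModuleCat.{u} A ⥤ ModuleCat.{u} R where
  obj M := ModuleCat.of R (BalancedTensor R N M)
  map f := ModuleCat.ofHom (balancedMap R N f)
  map_id M := by
    ext : 1
    refine Submodule.linearMap_qext _ (TensorProduct.ext' fun n m => ?_)
    rfl
  map_comp f g := by
    ext : 1
    refine Submodule.linearMap_qext _ (TensorProduct.ext' fun n m => ?_)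
    rfl

instance (N : ModuleCat.{u} Aᵐᵒᵖ) : (tensorFunctor R N).Additive where
  map_add {M M' f g} := by
    ext : 1
    refine Submodule.linearMap_qext _ (TensorProduct.ext' fun n m => ?_)
    exact congrArg (Submodule.Quotient.mk (p := balancedSubmodule R N M'))
      (TensorProduct.tmul_add n (f.hom m) (g.hom m))

/-- The `R`-module `Tor_i^A(N, M)` for `i : ℤ`: the `i`-th left derived functor of `N ⊗_A -`
evaluated at `M` if `i ≥ 0`, and zero if `i < 0`. -/
def TorInt (N : ModuleCat.{u} Aᵐᵒᵖ) (M : ModuleCat.{u} A) : ℤ → ModuleCat.{u} R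
  | .ofNat n => ((tensorFunctor R N).leftDerived n).obj M
  | .negSucc _ => ModuleCat.of R PUnit

end Tensor

section Ext

/-- The `R`-module `Ext^i_A(L, M)` for `i : ℤ`, which is zero if `i < 0`. -/
def ExtInt (R : Type u) [CommRing R] {A : Type u} [Ring A] [Algebra R A]
    (L M : ModuleCat.{u} A) : ℤ → ModuleCat.{u} R
  | .ofNat n => ModuleCat.of R (Abelian.Ext.{u} L M n)
  | .negSucc _ => ModuleCat.of R PUnit

variable {A : Type u} [Ring A]

/-- Right multiplication `x ↦ x * a`, as an endomorphism of the left `A`-module `A`. -/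
def rightMul (a : A) : ModuleCat.of A A ⟶ ModuleCat.of A A :=
  ModuleCat.ofHom (LinearMap.toSpanSingleton A A a)

theorem rightMul_one : rightMul (1 : A) = 𝟙 _ := by
  ext; simp [rightMul]

theorem rightMul_mul (a b : A) : rightMul (a * b) = rightMul a ≫ rightMul b := by
  ext; simp [rightMul]

theorem rightMul_add (a b : A) : rightMul (a + b) = rightMul a + rightMul b := by
  ext; simp [rightMul]

theorem rightMul_zero : rightMul (0 : A) = 0 := by
  ext; simp [rightMul]

/-- The right `A`-module structure on `Ext^n_A(L, A)` given by right multiplication: `a` acts by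
functoriality in the second variable, through the endomorphism `x ↦ x * a` of `A`. -/
instance extRightModule (L : ModuleCat.{u} A) (n : ℕ) :
    Module Aᵐᵒᵖ (Abelian.Ext.{u} L (ModuleCat.of A A) n) where
  smul a ω := ω.comp (Abelian.Ext.mk₀ (rightMul a.unop)) (add_zero n)
  one_smul ω := by
    change ω.comp (Abelian.Ext.mk₀ (rightMul (1 : A))) (add_zero n) = ω
    rw [rightMul_one, Abelian.Ext.comp_mk₀_id]
  mul_smul a b ω := by
    change ω.comp (Abelian.Ext.mk₀ (rightMul (b.unop * a.unop))) (add_zero n) =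
      (ω.comp (Abelian.Ext.mk₀ (rightMul b.unop)) (add_zero n)).comp
        (Abelian.Ext.mk₀ (rightMul a.unop)) (add_zero n)
    rw [rightMul_mul, Abelian.Ext.comp_assoc_of_third_deg_zero, Abelian.Ext.mk₀_comp_mk₀]
  smul_zero a := by
    change (0 : Abelian.Ext.{u} L (ModuleCat.of A A) n).comp
      (Abelian.Ext.mk₀ (rightMul a.unop)) (add_zero n) = 0
    rw [Abelian.Ext.zero_comp]
  smul_add a x y := Abelian.Ext.add_comp _ _ _ _
  add_smul a b ω := by
    change ω.comp (Abelian.Ext.mk₀ (rightMul (a.unop + b.unop))) (add_zero n) =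
      ω.comp (Abelian.Ext.mk₀ (rightMul a.unop)) (add_zero n) +
        ω.comp (Abelian.Ext.mk₀ (rightMul b.unop)) (add_zero n)
    rw [rightMul_add, Abelian.Ext.mk₀_add, Abelian.Ext.comp_add]
  zero_smul ω := by
    change ω.comp (Abelian.Ext.mk₀ (rightMul (0 : A))) (add_zero n) = 0
    rw [rightMul_zero, Abelian.Ext.mk₀_zero, Abelian.Ext.comp_zero]

/-- The right `A`-module `Ω_A = Ext^d_A(L, A)`, for a left `A`-module `L`. -/
def Omega (L : ModuleCat.{u} A) (d : ℕ) : ModuleCat.{u} Aᵐᵒᵖ :=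
  ModuleCat.of Aᵐᵒᵖ (Abelian.Ext.{u} L (ModuleCat.of A A) d)

end Ext

end QuantumDuality

end

-- Write `A` for A_h, L for the `A`-module K and Ω for Ext^d(L, A). The theorem is a duality by
-- dimension shifting. It needs Ext^i(L, A) = 0 for i ≠ d, and Ext^i(L, -) = 0 for i > d.
--
-- The first vanishing is lifted from A₀. Inside Aⁿ, the syzygies of L are h-saturated. They are
-- therefore finitely generated (lift generators modulo h and sum the corrections h-adically) and
-- h-torsion free, and they reduce modulo h to syzygies of k. Dimension shifting leaves only degrees
-- 0 and 1, where a homomorphism is killed or extended modulo h, divided by h, and the step is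
-- iterated (`subsingleton_ext_of_reduction`).
--
-- The same syzygies show that Ext^i(L, -) commutes with direct sums of copies of A, so Ext^i(L, P)
-- = 0 for P projective and i ≠ d. Descending induction from the projective dimension of L gives the
-- second vanishing. Hence Ext^d(L, -) is right exact, and the natural map Ω ⊗_A M → Ext^d(L, M) is
-- bijective because it is so for M free (`comparison_bijective`).
--
-- Finally let B_j be the syzygies of a projective resolution Q of M, with B_0 = M. Both
-- Tor_{j+1}(Ω, M) and Ext^{d-1}(L, B_j) are the kernel of Ext^d(L, B_{j+1}) → Ext^d(L, Q_j), and
-- connecting maps identify the latter with Ext^{d-1-j}(L, M).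

universe w

noncomputable section

namespace QuantumDuality

/-! ### Completeness in h and successive approximation -/

section FormalParameter

/-- A central nonzerodivisor `h` of a ring `A` such that `A` is separated and complete for the
`h`-adic topology. -/
structure IsFormalParameter {A : Type u} [Ring A] (h : A) : Prop where
  comm : ∀ a, h * a = a * h
  eq_zero_of_mul_eq_zero : ∀ a, h * a = 0 → a = 0
  eq_zero_of_forall_pow_dvd : ∀ a, (∀ n : ℕ, h ^ n ∣ a) → a = 0
  exists_sum : ∀ a : ℕ → A, ∃ s, ∀ n, h ^ n ∣ s - ∑ j ∈ Finset.range n, h ^ j * a j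

/-- In the coordinates V⟦h⟧, multiplication by hⁿ shifts coefficients by n. Divisibility by hⁿ thus
means that the first n coefficients vanish, and an h-adic series has a finite sum in each degree. -/
theorem Deformation.isFormalParameter {k A₀ A : Type u} [Field k] [Ring A₀] [Algebra k A₀]
    [Ring A] [Algebra k⟦X⟧ A] (D : Deformation k A₀ A) :
    IsFormalParameter (algebraMap k⟦X⟧ A PowerSeries.X) := by
  obtain ⟨V, _, _, e, he⟩ := D.isTopologicallyFree
  have key : ∀ (n : ℕ) (a : A) (m : ℕ),
      e (algebraMap k⟦X⟧ A PowerSeries.X ^ n * a) m = if n ≤ m then e a (m - n) else 0 := by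
    intro n a m
    rw [← map_pow, ← Algebra.smul_def, he]
    split_ifs with hnm
    · rw [Finset.sum_eq_single (n, m - n)]
      · simp [PowerSeries.coeff_X_pow]
      · rintro ⟨i, j⟩ hij hne
        rw [Finset.HasAntidiagonal.mem_antidiagonal] at hij
        have : i ≠ n := by rintro rfl; apply hne; ext <;> simp at hij ⊢; omega
        simp [PowerSeries.coeff_X_pow, this]
      · intro hn
        simp at hn
        omega
    · refine Finset.sum_eq_zero ?_
      rintro ⟨i, j⟩ hij
      rw [Finset.HasAntidiagonal.mem_antidiagonal] at hij
      have : i ≠ n := by simp at hij; omega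
      simp [PowerSeries.coeff_X_pow, this]
  have dvd : ∀ (n : ℕ) (a : A), (∀ m < n, e a m = 0) →
      algebraMap k⟦X⟧ A PowerSeries.X ^ n ∣ a := by
    intro n a ha
    refine ⟨e.symm fun m => e a (m + n), e.injective (funext fun m => ?_)⟩
    rw [key]
    split_ifs with hnm
    · simp [Nat.sub_add_cancel hnm]
    · exact ha m (by omega)
  refine ⟨fun a => Algebra.commutes _ _, fun a ha => ?_, fun a ha => ?_, fun a => ?_⟩
  · refine e.injective (funext fun m => ?_)
    have := key 1 a (m + 1)
    rw [pow_one, ha] at this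
    simpa using this.symm
  · refine e.injective (funext fun m => ?_)
    obtain ⟨b, hb⟩ := ha (m + 1)
    rw [hb, key]
    simp
  · refine ⟨e.symm fun n => ∑ j ∈ Finset.range (n + 1), e (a j) (n - j), fun n => dvd n _ ?_⟩
    intro m hm
    rw [map_sub, Pi.sub_apply, AddEquiv.apply_symm_apply, map_sum, Finset.sum_apply, sub_eq_zero]
    simp only [key]
    rw [← Finset.sum_filter]
    refine Finset.sum_congr ?_ fun _ _ => rfl
    ext j
    simp
    omega

variable {A A₀ : Type u} [Ring A] [Ring A₀] {h : A}

theorem IsFormalParameter.comm_pow (hh : IsFormalParameter h) (n : ℕ) (a : A) :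
    h ^ n * a = a * h ^ n :=
  ((show Commute h a from hh.comm a).pow_left n).eq

theorem IsFormalParameter.dvd_mul (hh : IsFormalParameter h) {n : ℕ} {a : A} (b : A)
    (ha : h ^ n ∣ a) : h ^ n ∣ b * a := by
  obtain ⟨c, rfl⟩ := ha
  exact ⟨b * c, by rw [← mul_assoc, ← hh.comm_pow, mul_assoc]⟩

/-- The coordinatewise reduction `Aⁿ → A₀ⁿ`. -/
def piRed (red : A →+* A₀) (n : ℕ) : (Fin n → A) →ₛₗ[red] (Fin n → A₀) where
  toFun x i := red (x i)
  map_add' x y := by ext; simp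
  map_smul' a x := by ext; simp

theorem piRed_surjective {red : A →+* A₀} (hs : Function.Surjective red) (n : ℕ) :
    Function.Surjective (piRed red n) := fun y =>
  ⟨fun i => (hs (y i)).choose, funext fun i => (hs (y i)).choose_spec⟩

theorem piRed_eq_zero_iff {red : A →+* A₀} (hk : ∀ a, red a = 0 ↔ ∃ b, a = h * b) (n : ℕ)
    (x : Fin n → A) : piRed red n x = 0 ↔ ∃ y, x = h • y := by
  constructor
  · intro hx
    have : ∀ i, ∃ b, x i = h * b := fun i => (hk _).1 (congrFun hx i)
    choose y hy using this
    exact ⟨y, funext hy⟩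
  · rintro ⟨y, rfl⟩
    exact funext fun i => (hk _).2 ⟨y i, rfl⟩

/-- Successive approximation. -/
theorem exists_sequence_of_step {M : Type*} [AddCommGroup M] [Module A M] {X G : Type*}
    (u : X → M) (g : G → M) (step : ∀ x, ∃ a x', u x = g a + h • u x') (x : X) :
    ∃ (a : ℕ → G) (y : ℕ → X), ∀ n,
      u x = ∑ j ∈ Finset.range n, h ^ j • g (a j) + h ^ n • u (y n) := by
  choose α β hαβ using step
  refine ⟨fun n => α (β^[n] x), fun n => β^[n] x, fun n => ?_⟩
  induction n with
  | zero => simp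
  | succ n ih =>
    rw [ih, Finset.sum_range_succ, add_assoc, pow_succ, mul_smul, ← smul_add]
    simp only [Function.iterate_succ_apply']
    rw [← hαβ]

/-- If `A₀ = A / hA` is left noetherian, then the `h`-saturated submodules of `Aⁿ` are finitely
generated. -/
theorem IsFormalParameter.fg_of_saturated (hh : IsFormalParameter h) [IsNoetherianRing A₀]
    {red : A →+* A₀} (hs : Function.Surjective red) (hk : ∀ a, red a = 0 ↔ ∃ b, a = h * b)
    {n : ℕ} (N : Submodule A (Fin n → A)) (hN : ∀ x, h • x ∈ N → x ∈ N) : N.FG := by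
  have : RingHomSurjective red := ⟨hs⟩
  obtain ⟨m, s, hsp⟩ := Submodule.fg_iff_exists_fin_generating_family.1
    (IsNoetherian.noetherian (N.map (piRed red n)))
  have hmem : ∀ j, s j ∈ N.map (piRed red n) := fun j => hsp ▸ Submodule.subset_span ⟨j, rfl⟩
  choose t htN hts using hmem
  have step : ∀ x : N, ∃ (a : Fin m → A) (x' : N),
      (x : Fin n → A) = ∑ j, a j • t j + h • (x' : Fin n → A) := by
    rintro ⟨x, hx⟩
    have h1 : piRed red n x ∈ Submodule.span A₀ (Set.range s) :=
      hsp ▸ Submodule.mem_map_of_mem hx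
    obtain ⟨c, hc⟩ := (Submodule.mem_span_range_iff_exists_fun A₀).1 h1
    choose a ha using fun j => hs (c j)
    have h2 : piRed red n (x - ∑ j, a j • t j) = 0 := by
      rw [map_sub, map_sum, ← hc, sub_eq_zero]
      exact Finset.sum_congr rfl fun j _ => by rw [LinearMap.map_smulₛₗ, ha, hts]
    obtain ⟨y, hy⟩ := (piRed_eq_zero_iff hk n _).1 h2
    -- Saturation keeps the quotient of the error by h inside N, so the approximation can be
    -- repeated.
    have h3 : y ∈ N := hN y (hy ▸ N.sub_mem hx (N.sum_mem fun j _ => N.smul_mem _ (htN j)))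
    exact ⟨a, ⟨y, h3⟩, by simp [← hy]⟩
  refine Submodule.fg_iff_exists_fin_generating_family.2 ⟨m, t, le_antisymm ?_ fun x hx => ?_⟩
  · exact Submodule.span_le.2 (Set.range_subset_iff.2 htN)
  · obtain ⟨a, y, hay⟩ := exists_sequence_of_step (X := N) (fun x => (x : Fin n → A))
      (fun a : Fin m → A => ∑ j, a j • t j) step ⟨x, hx⟩
    choose σ hσ using fun j => hh.exists_sum fun i => a i j
    refine (Submodule.mem_span_range_iff_exists_fun A).2 ⟨σ, ?_⟩
    refine funext fun i => sub_eq_zero.1 (hh.eq_zero_of_forall_pow_dvd _ fun r => ?_)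
    have h1 := congrFun (hay r) i
    have h2 : (∑ j, σ j • t j) i - x i =
        ∑ j, (σ j - ∑ l ∈ Finset.range r, h ^ l * a l j) * t j i - h ^ r * (y r : Fin n → A) i := by
      simp only [Finset.sum_apply, Pi.smul_apply, smul_eq_mul, Pi.add_apply] at h1 ⊢
      rw [h1]
      simp only [sub_mul, Finset.sum_sub_distrib, Finset.sum_mul, Finset.mul_sum, mul_assoc]
      rw [Finset.sum_comm]
      abel
    rw [h2]
    refine dvd_sub (Finset.dvd_sum fun j _ => ?_) (Dvd.intro _ rfl)
    exact (hσ j r).trans (Dvd.intro _ rfl)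

/-- Iterating `step` expands f on N as an h-adic series of maps defined on Aⁿ. These are determined
by their values on basis vectors, so the series is summed there; the error is divisible by every
power of h. -/
theorem IsFormalParameter.exists_extension (hh : IsFormalParameter h) {n : ℕ}
    (N : Submodule A (Fin n → A))
    (step : ∀ f : N →ₗ[A] A, ∃ (g : (Fin n → A) →ₗ[A] A) (f' : N →ₗ[A] A),
      ∀ x, f x = g x + h * f' x) (f : N →ₗ[A] A) :
    ∃ g : (Fin n → A) →ₗ[A] A, ∀ x : N, g x = f x := by
  obtain ⟨a, y, hay⟩ := exists_sequence_of_step (h := h) (X := N →ₗ[A] A) (M := N → A)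
    (fun f => f) (fun (g : (Fin n → A) →ₗ[A] A) x => g x)
    (fun f => (step f).imp fun g hg => hg.imp fun f' hf' => funext hf') f
  choose σ hσ using fun i : Fin n => hh.exists_sum fun l => a l (Pi.single i 1)
  refine ⟨Fintype.linearCombination A σ, fun x => ?_⟩
  refine sub_eq_zero.1 (hh.eq_zero_of_forall_pow_dvd _ fun r => ?_)
  have h1 := congrFun (hay r) x
  have h3 : ∀ (g : (Fin n → A) →ₗ[A] A) (x : Fin n → A), g x = ∑ i, x i * g (Pi.single i 1) := by
    intro g x
    conv_lhs => rw [pi_eq_sum_univ' x]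
    simp [map_sum]
  have h2 : Fintype.linearCombination A σ (x : Fin n → A) - f x =
      ∑ i, (x : Fin n → A) i * (σ i - ∑ l ∈ Finset.range r, h ^ l * a l (Pi.single i 1)) -
        h ^ r * y r x := by
    simp only [Finset.sum_apply, Pi.smul_apply, smul_eq_mul, Pi.add_apply] at h1
    rw [h1, Fintype.linearCombination_apply]
    simp only [smul_eq_mul, mul_sub, Finset.sum_sub_distrib, Finset.mul_sum]
    rw [Finset.sum_comm, sub_add_eq_sub_sub]
    congr 2
    refine Finset.sum_congr rfl fun l _ => ?_
    rw [h3, Finset.mul_sum]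
    exact Finset.sum_congr rfl fun i _ => by rw [← mul_assoc, hh.comm_pow, mul_assoc]
  rw [h2]
  exact dvd_sub (Finset.dvd_sum fun i _ => hh.dvd_mul _ (hσ i r)) (Dvd.intro _ rfl)

/-- `L` has no `h`-torsion. -/
def IsTorsionFreeAt (h : A) (L : Type*) [AddCommGroup L] [Module A L] : Prop :=
  ∀ x : L, h • x = 0 → x = 0

/-- Quotients by h are unique since h is a nonzerodivisor, which makes them additive; centrality of
h makes them `A`-linear. -/
theorem IsFormalParameter.exists_div (hh : IsFormalParameter h) {red : A →+* A₀}
    (hk : ∀ a, red a = 0 ↔ ∃ b, a = h * b) {N : Type*} [AddCommGroup N] [Module A N]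
    (f : N →ₗ[A] A) (hf : ∀ x, red (f x) = 0) : ∃ f' : N →ₗ[A] A, ∀ x, f x = h * f' x := by
  choose φ hφ using fun x => (hk _).1 (hf x)
  have cancel : ∀ {a b : A}, h * a = h * b → a = b := fun {a b} hab =>
    sub_eq_zero.1 (hh.eq_zero_of_mul_eq_zero _ (by rw [mul_sub, hab, sub_self]))
  refine ⟨⟨⟨φ, fun x y => cancel ?_⟩, fun a x => cancel ?_⟩, hφ⟩
  · rw [mul_add, ← hφ, ← hφ, ← hφ, map_add]
  · simp only [RingHom.id_apply, smul_eq_mul]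
    rw [← hφ, map_smul, hφ x, smul_eq_mul, ← mul_assoc, ← mul_assoc, hh.comm]

/-- A semilinear map `π : L → L₀` exhibits `L₀` as the reduction `L / hL`. -/
structure IsReduction (h : A) {red : A →+* A₀} {L L₀ : Type*} [AddCommGroup L] [Module A L]
    [AddCommGroup L₀] [Module A₀ L₀] (π : L →ₛₗ[red] L₀) : Prop where
  surjective : Function.Surjective π
  eq_zero_iff : ∀ x, π x = 0 ↔ ∃ y, x = h • y

theorem IsReduction.exists_descend {red : A →+* A₀} (hs : Function.Surjective red)
    {L L₀ Y : Type*} [AddCommGroup L] [Module A L]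
    [AddCommGroup L₀] [Module A₀ L₀] [AddCommGroup Y] [Module A₀ Y] {π : L →ₛₗ[red] L₀}
    (hπ : IsReduction h π) (f : L →ₛₗ[red] Y) (hf : ∀ x, f (h • x) = 0) :
    ∃ g : L₀ →ₗ[A₀] Y, ∀ x, g (π x) = f x := by
  have key : ∀ x y, π x = π y → f x = f y := by
    intro x y hxy
    rw [← sub_eq_zero, ← map_sub] at hxy
    obtain ⟨z, hz⟩ := (hπ.eq_zero_iff _).1 hxy
    rw [← sub_eq_zero, ← map_sub, hz, hf]
  choose σ hσ using hπ.surjective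
  refine ⟨⟨⟨fun y => f (σ y), fun x y => ?_⟩, fun a x => ?_⟩, fun x => key _ _ (hσ _)⟩
  · rw [← map_add]
    exact key _ _ (by rw [map_add, hσ, hσ, hσ])
  · obtain ⟨b, rfl⟩ := hs a
    change f _ = red b • f (σ x)
    rw [← LinearMap.map_smulₛₗ f]
    exact key _ _ (by rw [LinearMap.map_smulₛₗ, hσ, hσ])

end FormalParameter

/-! ### Dimension shifting in the first variable -/

section DimensionShift

open Abelian

variable {C : Type u} [Category.{v} C] [Abelian C] [HasExt.{w} C] {S : ShortComplex C}
  (hS : S.ShortExact) [Projective S.X₂] (Y : C)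

theorem extClass_precomp_surjective {n m : ℕ} (hnm : 1 + n = m) (x : Ext.{w} S.X₃ Y m) :
    ∃ y : Ext.{w} S.X₁ Y n, hS.extClass.comp y hnm = x := by
  obtain rfl : m = n + 1 := by omega
  exact Ext.contravariant_sequence_exact₃ hS Y x (Ext.eq_zero_of_projective _) hnm

include hS in
-- Degree 1 is separate from the higher degrees because Hom(X₂, Y) need not vanish: Ext¹(X₃, Y) is
-- the cokernel of Hom(X₂, Y) → Hom(X₁, Y).
theorem subsingleton_ext_one_iff :
    Subsingleton (Ext.{w} S.X₃ Y 1) ↔ ∀ f : S.X₁ ⟶ Y, ∃ g : S.X₂ ⟶ Y, S.f ≫ g = f := by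
  constructor
  · intro hsub f
    obtain ⟨y, hy⟩ := Ext.contravariant_sequence_exact₁ hS Y (Ext.mk₀ f) (add_zero 1)
      (Subsingleton.elim _ _)
    obtain ⟨g, rfl⟩ := (Ext.mk₀_bijective _ _).2 y
    rw [Ext.mk₀_comp_mk₀] at hy
    exact ⟨g, (Ext.mk₀_bijective _ _).1 hy⟩
  · refine fun hext => subsingleton_of_forall_eq 0 fun x => ?_
    obtain ⟨y, rfl⟩ := extClass_precomp_surjective hS Y (add_zero 1) x
    obtain ⟨f, rfl⟩ := (Ext.mk₀_bijective _ _).2 y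
    obtain ⟨g, rfl⟩ := hext f
    rw [← Ext.mk₀_comp_mk₀, hS.extClass_comp_assoc]

include hS in
theorem subsingleton_ext_succ_iff (n : ℕ) :
    Subsingleton (Ext.{w} S.X₃ Y (n + 2)) ↔ Subsingleton (Ext.{w} S.X₁ Y (n + 1)) := by
  have hn : 1 + (n + 1) = n + 2 := by omega
  constructor
  · refine fun hsub => subsingleton_of_forall_eq 0 fun y => ?_
    obtain ⟨z, rfl⟩ := Ext.contravariant_sequence_exact₁ hS Y y hn (Subsingleton.elim _ _)
    rw [Ext.eq_zero_of_projective z, Ext.comp_zero]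
  · refine fun hsub => subsingleton_of_forall_eq 0 fun x => ?_
    obtain ⟨y, rfl⟩ := extClass_precomp_surjective hS Y hn x
    rw [Subsingleton.elim y 0, Ext.comp_zero]

end DimensionShift

/-! ### Lifting the vanishing of Ext(-, A) from A₀ to A -/

section Vanishing

open Abelian

variable {A A₀ : Type u} [Ring A] [Ring A₀] {h : A}

theorem subsingleton_ext_zero_iff {R : Type u} [Ring R] (L M : ModuleCat.{u} R) :
    Subsingleton (Ext.{u} L M 0) ↔ ∀ f : L →ₗ[R] M, f = 0 := by
  rw [Ext.homEquiv₀.subsingleton_congr, ModuleCat.homEquiv.subsingleton_congr]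
  exact ⟨fun _ f => Subsingleton.elim _ _, fun hf => subsingleton_of_forall_eq 0 hf⟩

theorem IsTorsionFreeAt.ker_saturated {P L : Type*} [AddCommGroup P] [Module A P]
    [AddCommGroup L] [Module A L] (hL : IsTorsionFreeAt h L) (p : P →ₗ[A] L) (x : P)
    (hx : h • x ∈ LinearMap.ker p) : x ∈ LinearMap.ker p :=
  hL _ (by rw [← map_smul]; exact hx)

theorem IsFormalParameter.isTorsionFreeAt_submodule (hh : IsFormalParameter h) {n : ℕ}
    (N : Submodule A (Fin n → A)) : IsTorsionFreeAt h N := fun _ hx =>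
  Subtype.ext (funext fun i => hh.eq_zero_of_mul_eq_zero _ (congrFun (congrArg Subtype.val hx) i))

/-- If `L₀ = L / hL` with `L` finitely generated without `h`-torsion, then `L = Aⁿ / N` and
`L₀ = A₀ⁿ / N₀` with `N₀ = N / hN`. -/
theorem IsReduction.exists_presentation {red : A →+* A₀}
    (hs : Function.Surjective red) (hk : ∀ a, red a = 0 ↔ ∃ b, a = h * b)
    {L L₀ : Type u} [AddCommGroup L] [Module A L] [AddCommGroup L₀] [Module A₀ L₀]
    [Module.Finite A L] (hL : IsTorsionFreeAt h L) {π : L →ₛₗ[red] L₀} (hπ : IsReduction h π) :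
    ∃ (n : ℕ) (p : (Fin n → A) →ₗ[A] L) (p₀ : (Fin n → A₀) →ₗ[A₀] L₀)
      (ρ : LinearMap.ker p →ₛₗ[red] LinearMap.ker p₀), Function.Surjective p ∧
      Function.Surjective p₀ ∧ IsReduction h ρ ∧
      ∀ x, (ρ x : Fin n → A₀) = piRed red n (x : Fin n → A) := by
  obtain ⟨n, p, hp⟩ := Module.Finite.exists_fin' A L
  let p₀ : (Fin n → A₀) →ₗ[A₀] L₀ :=
    Fintype.linearCombination A₀ fun i => π (p (Pi.single i 1))
  have hcomp : ∀ x, p₀ (piRed red n x) = π (p x) := by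
    intro x
    conv_rhs => rw [pi_eq_sum_univ' x]
    simp only [map_sum, map_smul, LinearMap.map_smulₛₗ]
    exact Fintype.linearCombination_apply A₀ _ _
  let ρ : LinearMap.ker p →ₛₗ[red] LinearMap.ker p₀ :=
    { toFun := fun x => ⟨piRed red n x, by
        rw [LinearMap.mem_ker, hcomp, LinearMap.mem_ker.1 x.2, map_zero]⟩
      map_add' := fun x y => Subtype.ext (map_add (piRed red n) (x : Fin n → A) y)
      map_smul' := fun a x => Subtype.ext (LinearMap.map_smulₛₗ (piRed red n) a (x : Fin n → A)) }
  refine ⟨n, p, p₀, ρ, hp, fun y => ?_, ⟨?_, ?_⟩, fun _ => rfl⟩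
  · obtain ⟨x, rfl⟩ := hπ.surjective y
    obtain ⟨z, rfl⟩ := hp x
    exact ⟨_, hcomp z⟩
  · rintro ⟨y, hy⟩
    obtain ⟨x, rfl⟩ := piRed_surjective hs n y
    rw [LinearMap.mem_ker, hcomp, hπ.eq_zero_iff] at hy
    obtain ⟨z, hz⟩ := hy
    obtain ⟨w, rfl⟩ := hp z
    -- A lift of y to Aⁿ only maps into hL; subtracting h • w moves it into the kernel without
    -- changing its reduction.
    refine ⟨⟨x - h • w, by rw [LinearMap.mem_ker, map_sub, map_smul, hz, sub_self]⟩,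
      Subtype.ext ?_⟩
    change piRed red n (x - h • w) = piRed red n x
    rw [map_sub, (piRed_eq_zero_iff hk n _).2 ⟨w, rfl⟩, sub_zero]
  · intro x
    rw [Subtype.ext_iff]
    change piRed red n (x : Fin n → A) = 0 ↔ _
    rw [piRed_eq_zero_iff hk]
    constructor
    · rintro ⟨y, hy⟩
      -- As L has no torsion, an element of the kernel that is divisible by h in Aⁿ is divisible by
      -- h in the kernel.
      exact ⟨⟨y, hL.ker_saturated p y (hy ▸ x.2)⟩, Subtype.ext hy⟩
    · rintro ⟨y, hy⟩
      exact ⟨y, congrArg Subtype.val hy⟩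

/-- Modulo h every f becomes a map L₀ → A₀, hence zero, so f = h f'. Repeating this with f' makes
the values of f divisible by all powers of h. -/
theorem IsFormalParameter.eq_zero_of_reduction (hh : IsFormalParameter h)
    {red : A →+* A₀} (hs : Function.Surjective red) (hk : ∀ a, red a = 0 ↔ ∃ b, a = h * b)
    {L L₀ : Type u} [AddCommGroup L] [Module A L] [AddCommGroup L₀] [Module A₀ L₀]
    {π : L →ₛₗ[red] L₀} (hπ : IsReduction h π) (h₀ : ∀ f : L₀ →ₗ[A₀] A₀, f = 0) (f : L →ₗ[A] A) :
    f = 0 := by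
  have step : ∀ f : L →ₗ[A] A, ∃ f' : L →ₗ[A] A, ∀ x, f x = h * f' x := by
    intro f
    refine hh.exists_div hk f fun x => ?_
    obtain ⟨g, hg⟩ := hπ.exists_descend hs (red.toSemilinearMap.comp f) fun x => by
      change red (f (h • x)) = 0
      rw [map_smul]
      exact (hk _).2 ⟨_, rfl⟩
    have := hg x
    rw [h₀ g] at this
    exact this.symm
  refine LinearMap.ext fun x => hh.eq_zero_of_forall_pow_dvd _ fun n => ?_
  induction n generalizing f with
  | zero => simp
  | succ n ih =>
    obtain ⟨f', hf'⟩ := step f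
    obtain ⟨c, hc⟩ := ih f'
    exact ⟨c, by rw [hf', hc, ← mul_assoc, pow_succ']⟩

/-- Reduce f modulo h, extend over A₀ⁿ, and lift the extension to Aⁿ by lifting its values on the
basis. The discrepancy on N vanishes modulo h, hence is h times another map: this is the step of
`exists_extension`. -/
theorem IsFormalParameter.exists_extension_of_reduction (hh : IsFormalParameter h)
    {red : A →+* A₀} (hs : Function.Surjective red) (hk : ∀ a, red a = 0 ↔ ∃ b, a = h * b)
    {n : ℕ} (N : Submodule A (Fin n → A)) (N₀ : Submodule A₀ (Fin n → A₀)) {ρ : N →ₛₗ[red] N₀}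
    (hρ : IsReduction h ρ) (hρ' : ∀ x, (ρ x : Fin n → A₀) = piRed red n (x : Fin n → A))
    (h₀ : ∀ f : N₀ →ₗ[A₀] A₀, ∃ g : (Fin n → A₀) →ₗ[A₀] A₀, ∀ x : N₀, g x = f x)
    (f : N →ₗ[A] A) : ∃ g : (Fin n → A) →ₗ[A] A, ∀ x : N, g x = f x := by
  refine hh.exists_extension N (fun f => ?_) f
  obtain ⟨f₀, hf₀⟩ := hρ.exists_descend hs (red.toSemilinearMap.comp f) fun x => by
    change red (f (h • x)) = 0
    rw [map_smul]
    exact (hk _).2 ⟨_, rfl⟩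
  obtain ⟨g₀, hg₀⟩ := h₀ f₀
  choose c hc using fun i => hs (g₀ (Pi.single i 1))
  let g : (Fin n → A) →ₗ[A] A := Fintype.linearCombination A c
  have hg : ∀ x, red (g x) = g₀ (piRed red n x) := by
    intro x
    conv_rhs => rw [pi_eq_sum_univ' (piRed red n x)]
    simp only [g, Fintype.linearCombination_apply, map_sum, map_smul, smul_eq_mul, map_mul, hc]
    rfl
  obtain ⟨f', hf'⟩ := hh.exists_div hk (f - g ∘ₗ N.subtype) fun x => by
    change red (f x - g x) = 0
    rw [map_sub, hg, ← hρ', hg₀, hf₀]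
    exact sub_self _
  exact ⟨g, f', fun x => by rw [← hf']; simp⟩

/-- Nakayama's lemma for `Ext(-, A)`. -/
theorem IsFormalParameter.subsingleton_ext_of_reduction (hh : IsFormalParameter h)
    [IsNoetherianRing A₀]
    {red : A →+* A₀} (hs : Function.Surjective red) (hk : ∀ a, red a = 0 ↔ ∃ b, a = h * b)
    (i : ℕ) {L L₀ : Type u} [AddCommGroup L] [Module A L] [AddCommGroup L₀] [Module A₀ L₀]
    [Module.Finite A L] (hL : IsTorsionFreeAt h L) {π : L →ₛₗ[red] L₀} (hπ : IsReduction h π)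
    (h₀ : Subsingleton (Ext.{u} (ModuleCat.of A₀ L₀) (ModuleCat.of A₀ A₀) i)) :
    Subsingleton (Ext.{u} (ModuleCat.of A L) (ModuleCat.of A A) i) := by
  induction i generalizing L L₀ with
  | zero =>
    rw [subsingleton_ext_zero_iff] at h₀ ⊢
    exact hh.eq_zero_of_reduction hs hk hπ h₀
  | succ i ih =>
    obtain ⟨n, p, p₀, ρ, hp, hp₀, hρ, hρ'⟩ := hπ.exists_presentation hs hk hL
    have hS := p.shortExact_shortComplexKer hp
    have hS₀ := p₀.shortExact_shortComplexKer hp₀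
    have : Projective p.shortComplexKer.X₂ :=
      inferInstanceAs (Projective (ModuleCat.of A (Fin n → A)))
    have : Projective p₀.shortComplexKer.X₂ :=
      inferInstanceAs (Projective (ModuleCat.of A₀ (Fin n → A₀)))
    cases i with
    | zero =>
      refine (subsingleton_ext_one_iff hS _).2 fun f => ?_
      have h₁ := (subsingleton_ext_one_iff hS₀ _).1 h₀
      obtain ⟨g, hg⟩ := hh.exists_extension_of_reduction hs hk _ _ hρ hρ' (fun f₀ => by
        obtain ⟨g₀, hg₀⟩ := h₁ (ModuleCat.ofHom f₀)
        exact ⟨g₀.hom, fun x => congr($hg₀ x)⟩) f.hom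
      exact ⟨ModuleCat.ofHom g, by ext x; exact hg x⟩
    | succ i =>
      -- The syzygy is again finitely generated, torsion free and equipped with a reduction, so the
      -- induction hypothesis applies to it.
      have : Module.Finite A (LinearMap.ker p) :=
        Module.Finite.iff_fg.2 (hh.fg_of_saturated hs hk _ (hL.ker_saturated p))
      exact (subsingleton_ext_succ_iff hS _ i).2 <|
        ih (hh.isTorsionFreeAt_submodule _) hρ ((subsingleton_ext_succ_iff hS₀ _ i).1 h₀)

end Vanishing

/-! ### Ext into free and projective modules, and vanishing above d -/

section DirectSums

open Abelian

variable {A A₀ : Type u} [Ring A] [Ring A₀] {h : A}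

/-- The endomorphism of a free module which forgets the coordinates outside `s`. -/
def finsuppRestrict (A : Type u) [Ring A] {ι : Type u} (s : Finset ι) :
    ModuleCat.of A (ι →₀ A) ⟶ ModuleCat.of A (ι →₀ A) :=
  ∑ i ∈ s, ModuleCat.ofHom (Finsupp.lapply i) ≫ ModuleCat.ofHom (Finsupp.lsingle i)

theorem finsuppRestrict_apply {ι : Type u} (s : Finset ι) (f : ι →₀ A) (hf : f.support ⊆ s) :
    finsuppRestrict A s f = f := by
  have : (finsuppRestrict A s) f = ∑ i ∈ s, Finsupp.single i (f i) := by
    simp [finsuppRestrict, ModuleCat.hom_sum, LinearMap.sum_apply]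
  rw [this]
  exact (Finsupp.sum_of_support_subset f hf _ (by simp)).symm.trans f.sum_single

theorem mk₀_finsuppRestrict {ι : Type u} (s : Finset ι) :
    Ext.mk₀ (finsuppRestrict A s) = ∑ i ∈ s, (Ext.mk₀ (ModuleCat.ofHom (Finsupp.lapply i))).comp
      (Ext.mk₀ (ModuleCat.ofHom (Finsupp.lsingle i))) (add_zero 0) := by
  simp only [finsuppRestrict, Ext.mk₀_comp_mk₀]
  exact map_sum (Ext.addEquiv₀ (X := ModuleCat.of A (ι →₀ A))
    (Y := ModuleCat.of A (ι →₀ A))).symm _ _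

/-- A class with values in a free module has coefficients in a finite part of it. -/
theorem IsFormalParameter.exists_finset_comp_finsuppRestrict (hh : IsFormalParameter h)
    [IsNoetherianRing A₀]
    {red : A →+* A₀} (hs : Function.Surjective red) (hk : ∀ a, red a = 0 ↔ ∃ b, a = h * b)
    {ι : Type u} (i : ℕ) {L : Type u} [AddCommGroup L] [Module A L] [Module.Finite A L]
    (hL : IsTorsionFreeAt h L) (x : Ext.{u} (ModuleCat.of A L) (ModuleCat.of A (ι →₀ A)) i) :
    ∃ s : Finset ι, x.comp (Ext.mk₀ (finsuppRestrict A s)) (add_zero i) = x := by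
  classical
  induction i generalizing L with
  | zero =>
    obtain ⟨f, rfl⟩ := (Ext.mk₀_bijective _ _).2 x
    obtain ⟨n, p, hp⟩ := Module.Finite.exists_fin' A L
    -- The images of finitely many generators of L involve only finitely many coordinates.
    refine ⟨Finset.univ.biUnion fun j => (f (p (Pi.single j 1))).support, ?_⟩
    rw [Ext.mk₀_comp_mk₀]
    congr 1
    ext1
    rw [← LinearMap.cancel_right hp]
    refine (Pi.basisFun A (Fin n)).ext fun j => ?_
    rw [Pi.basisFun_apply]
    exact finsuppRestrict_apply _ _
      (Finset.subset_biUnion_of_mem (fun j => (f (p (Pi.single j 1))).support) (Finset.mem_univ j))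
  | succ i ih =>
    obtain ⟨n, p, hp⟩ := Module.Finite.exists_fin' A L
    have hS := p.shortExact_shortComplexKer hp
    have : Projective p.shortComplexKer.X₂ :=
      inferInstanceAs (Projective (ModuleCat.of A (Fin n → A)))
    have : Module.Finite A (LinearMap.ker p) :=
      Module.Finite.iff_fg.2 (hh.fg_of_saturated hs hk _ (hL.ker_saturated p))
    obtain ⟨y, rfl⟩ := extClass_precomp_surjective hS _ (add_comm 1 i) x
    obtain ⟨s, hs⟩ := ih (hh.isTorsionFreeAt_submodule _) y
    refine ⟨s, ?_⟩
    rw [Ext.comp_assoc_of_third_deg_zero]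
    exact congrArg (fun z => hS.extClass.comp z (add_comm 1 i)) hs

/-- A module `L` such that `Ext^i(L, -)` commutes with direct sums of copies of `A`. -/
def ExtFinitary (L : ModuleCat.{u} A) : Prop :=
  ∀ (i : ℕ) (ι : Type u) (x : Ext.{u} L (ModuleCat.of A (ι →₀ A)) i),
    ∃ s : Finset ι, x.comp (Ext.mk₀ (finsuppRestrict A s)) (add_zero i) = x

theorem ExtFinitary.exists_eq_sum {L : ModuleCat.{u} A} (hL : ExtFinitary L) {i : ℕ} {ι : Type u}
    (x : Ext.{u} L (ModuleCat.of A (ι →₀ A)) i) :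
    ∃ s : Finset ι, x = ∑ j ∈ s, (x.comp (Ext.mk₀ (ModuleCat.ofHom (Finsupp.lapply j)))
      (add_zero i)).comp (Ext.mk₀ (ModuleCat.ofHom (Finsupp.lsingle j))) (add_zero i) := by
  obtain ⟨s, hs⟩ := hL i ι x
  refine ⟨s, ?_⟩
  conv_lhs => rw [← hs, mk₀_finsuppRestrict]
  refine (map_sum (Ext.bilinearComp L (ModuleCat.of A (ι →₀ A)) (ModuleCat.of A (ι →₀ A)) i 0 i
    (add_zero i) x) _ _).trans (Finset.sum_congr rfl fun j _ => ?_)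
  exact (Ext.comp_assoc_of_third_deg_zero _ _ _ _).symm

/-- P is a retract of a free module, and a class with values there is a finite sum of classes that
factor through Ext^i(L, A) = 0. -/
theorem ExtFinitary.subsingleton_of_projective {L : ModuleCat.{u} A} (hL : ExtFinitary L) {i : ℕ}
    (h₀ : Subsingleton (Ext.{u} L (ModuleCat.of A A) i)) (P : ModuleCat.{u} A) [Projective P] :
    Subsingleton (Ext.{u} L P i) := by
  let π : ModuleCat.of A (P →₀ A) ⟶ P := ModuleCat.ofHom (Finsupp.linearCombination A id)
  have : Epi π := (ModuleCat.epi_iff_surjective _).2 (Finsupp.linearCombination_id_surjective A P)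
  refine subsingleton_of_forall_eq 0 fun x => ?_
  have hx : x = (x.comp (Ext.mk₀ (Projective.factorThru (𝟙 P) π)) (add_zero i)).comp
      (Ext.mk₀ π) (add_zero i) := by
    rw [Ext.comp_assoc_of_third_deg_zero, Ext.mk₀_comp_mk₀, Projective.factorThru_comp,
      Ext.comp_mk₀_id]
  obtain ⟨s, hs⟩ := hL.exists_eq_sum (x.comp (Ext.mk₀ (Projective.factorThru (𝟙 P) π)) (add_zero i))
  rw [hx, hs, Finset.sum_eq_zero, Ext.zero_comp]
  intro j _
  rw [Subsingleton.elim (Ext.comp _ (Ext.mk₀ (ModuleCat.ofHom (Finsupp.lapply j))) _) 0,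
    Ext.zero_comp]

/-- Descending induction on i from the projective dimension: if F → M is a free cover with kernel
M', then Ext^i(L, M) lies between Ext^i(L, F) = 0 and Ext^{i+1}(L, M') = 0. -/
theorem ExtFinitary.subsingleton_of_lt {L : ModuleCat.{u} A} (hL : ExtFinitary L) {d n : ℕ}
    (h₀ : ∀ i, d < i → Subsingleton (Ext.{u} L (ModuleCat.of A A) i))
    [HasProjectiveDimensionLT L n] {i : ℕ} (hi : d < i) (M : ModuleCat.{u} A) :
    Subsingleton (Ext.{u} L M i) := by
  obtain ⟨k, hk⟩ : ∃ k, n ≤ i + k := ⟨n, by omega⟩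
  induction k generalizing i M with
  | zero => exact HasProjectiveDimensionLT.subsingleton L n i hk M
  | succ k ih =>
    have hS := (Finsupp.linearCombination A (id : M → M)).shortExact_shortComplexKer
      (Finsupp.linearCombination_id_surjective A M)
    have := ih (i := i + 1) (by omega) (ModuleCat.of A
      (LinearMap.ker (Finsupp.linearCombination A (id : M → M)))) (by omega)
    have : Projective (ModuleCat.of A (M →₀ A)) := inferInstance
    have := hL.subsingleton_of_projective (h₀ i hi) (ModuleCat.of A (M →₀ A))
    refine subsingleton_of_forall_eq 0 fun x => ?_
    obtain ⟨y, hy⟩ := Ext.covariant_sequence_exact₃ L hS x rfl (Subsingleton.elim _ _)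
    rw [← hy]
    exact (congrArg (fun z => Ext.comp z _ (add_zero i)) (Subsingleton.elim y 0)).trans
      (Ext.zero_comp ..)

end DirectSums

/-! ### The comparison map Ω ⊗ M → Ext^d(L, M) -/

section Comparison

open Abelian

attribute [local instance] moduleOfAlgebra isScalarTower_of_algebra smulCommClass_of_algebra

variable (R : Type u) [CommRing R] {A : Type u} [Ring A] [Algebra R A]

/-- The morphism `A → M` which sends `1` to `m`. -/
def evalHom {M : ModuleCat.{u} A} (m : M) : ModuleCat.of A A ⟶ M :=
  ModuleCat.ofHom (LinearMap.toSpanSingleton A M m)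

theorem evalHom_add {M : ModuleCat.{u} A} (m m' : M) :
    evalHom (m + m') = evalHom m + evalHom m' := by
  ext; simp [evalHom]

theorem evalHom_smul {M : ModuleCat.{u} A} (r : R) (m : M) :
    evalHom (r • m) = r • evalHom m := by
  ext
  change (1 : A) • r • m = r • (1 : A) • m
  rw [one_smul, one_smul]

theorem rightMul_comp_evalHom {M : ModuleCat.{u} A} (a : A) (m : M) :
    rightMul a ≫ evalHom m = evalHom (a • m) := by
  ext; simp [evalHom, rightMul]

theorem evalHom_comp {M M' : ModuleCat.{u} A} (m : M) (f : M ⟶ M') :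
    evalHom m ≫ f = evalHom (f.hom m) := by
  ext; simp [evalHom]

/-- Two `R`-actions on Ω are reconciled: one through right multiplication by `A`, one from the
linear structure on Ext. Both are composition with the same endomorphism of `A`. -/
theorem smul_omega_eq {L : ModuleCat.{u} A} {d : ℕ} (r : R) (ω : Omega L d) :
    r • ω = (r • (show Ext.{u} L (ModuleCat.of A A) d from ω) :
      Ext.{u} L (ModuleCat.of A A) d) := by
  rw [Ext.smul_eq_comp_mk₀]
  change Ext.comp _ (Ext.mk₀ (rightMul (algebraMap R A r))) (add_zero d) = _
  congr 2
  ext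
  exact (one_mul (algebraMap R A r)).trans (mul_one (algebraMap R A r)).symm

/-- The image of `ω ∈ Ext^d(L, A)` under the map `A → M`, `1 ↦ m`. -/
def omegaEval {L : ModuleCat.{u} A} {d : ℕ} {M : ModuleCat.{u} A} (ω : Omega L d) (m : M) :
    Ext.{u} L M d :=
  Ext.comp (show Ext.{u} L (ModuleCat.of A A) d from ω) (Ext.mk₀ (evalHom m)) (add_zero d)

theorem omegaEval_comp {L : ModuleCat.{u} A} {d : ℕ} {M M' : ModuleCat.{u} A} (ω : Omega L d)
    (m : M) (f : M ⟶ M') :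
    (omegaEval ω m).comp (Ext.mk₀ f) (add_zero d) = omegaEval ω (f.hom m) := by
  rw [omegaEval, Ext.comp_assoc_of_third_deg_zero, Ext.mk₀_comp_mk₀, evalHom_comp]
  rfl

theorem omegaEval_smul {L : ModuleCat.{u} A} {d : ℕ} {M : ModuleCat.{u} A} (ω : Omega L d)
    (a : A) (m : M) : omegaEval ω (a • m) = omegaEval (MulOpposite.op a • ω) m := by
  rw [omegaEval, ← rightMul_comp_evalHom, ← Ext.mk₀_comp_mk₀, ← Ext.comp_assoc_of_third_deg_zero]
  rfl

/-- The class of `n ⊗ m` in `N ⊗_A M`. -/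
def balancedTmul (N : ModuleCat.{u} Aᵐᵒᵖ) (M : ModuleCat.{u} A) (n : N) (m : M) :
    BalancedTensor R N M :=
  Submodule.Quotient.mk (n ⊗ₜ[R] m)

/-- The map `Ext^d(L, A) ⊗_A M → Ext^d(L, M)` which sends `ω ⊗ m` to the image of `ω` under the
map `A → M`, `1 ↦ m`. -/
def comparison (L : ModuleCat.{u} A) (d : ℕ) (M : ModuleCat.{u} A) :
    BalancedTensor R (Omega L d) M →ₗ[R] Ext.{u} L M d :=
  (balancedSubmodule R (Omega L d) M).liftQ
    (TensorProduct.lift (LinearMap.mk₂ R (omegaEval (L := L) (d := d) (M := M))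
      (fun _ _ _ => Ext.add_comp _ _ _ _)
      (fun r ω m => by rw [smul_omega_eq]; exact Ext.smul_comp _ _ _ r)
      (fun _ _ _ => by
        rw [omegaEval, evalHom_add, Ext.mk₀_add]; exact Ext.comp_add _ _ _ _)
      (fun r ω m => by
        rw [omegaEval, evalHom_smul, Ext.mk₀_smul]; exact Ext.comp_smul _ _ _ r)))
    (by
      refine Submodule.span_le.2 ?_
      rintro _ ⟨ω, a, m, rfl⟩
      rw [SetLike.mem_coe, LinearMap.mem_ker, map_sub, sub_eq_zero, TensorProduct.lift.tmul,
        TensorProduct.lift.tmul]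
      exact (omegaEval_smul ω a m).symm)

theorem comparison_tmul (L : ModuleCat.{u} A) (d : ℕ) {M : ModuleCat.{u} A} (ω : Omega L d)
    (m : M) : comparison R L d M (balancedTmul R _ M ω m) = omegaEval ω m :=
  rfl

theorem comparison_balancedMap (L : ModuleCat.{u} A) (d : ℕ) {M M' : ModuleCat.{u} A} (f : M ⟶ M')
    (t : BalancedTensor R (Omega L d) M) :
    comparison R L d M' (balancedMap R (Omega L d) f t) =
      (comparison R L d M t).comp (Ext.mk₀ f) (add_zero d) := by
  have : comparison R L d M' ∘ₗ balancedMap R (Omega L d) f =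
      (Ext.mk₀ f).postcompOfLinear R L (add_zero d) ∘ₗ comparison R L d M := by
    refine Submodule.linearMap_qext _ (TensorProduct.ext' fun ω m => ?_)
    exact (omegaEval_comp ω m f).symm
  exact LinearMap.congr_fun this t

theorem balancedMap_surjective (N : ModuleCat.{u} Aᵐᵒᵖ) {M M' : ModuleCat.{u} A} (f : M ⟶ M')
    (hf : Function.Surjective f.hom) : Function.Surjective (balancedMap R N f) := by
  intro t
  obtain ⟨t, rfl⟩ := Submodule.Quotient.mk_surjective _ t
  obtain ⟨s, rfl⟩ := LinearMap.lTensor_surjective N (g := restrictHom R f) hf t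
  exact ⟨Submodule.Quotient.mk s, rfl⟩

theorem balancedMap_comp_apply (N : ModuleCat.{u} Aᵐᵒᵖ) {M M' M'' : ModuleCat.{u} A} (f : M ⟶ M')
    (g : M' ⟶ M'') (t : BalancedTensor R N M) :
    balancedMap R N g (balancedMap R N f t) = balancedMap R N (f ≫ g) t :=
  (congr($((tensorFunctor R N).map_comp f g) t)).symm

theorem balancedMap_zero_apply (N : ModuleCat.{u} Aᵐᵒᵖ) {M M' : ModuleCat.{u} A}
    (t : BalancedTensor R N M) : balancedMap R N (0 : M ⟶ M') t = 0 :=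
  congr($((tensorFunctor R N).map_zero M M') t)

theorem balancedTmul_smul (N : ModuleCat.{u} Aᵐᵒᵖ) (M : ModuleCat.{u} A) (n : N) (a : A) (m : M) :
    balancedTmul R N M n (a • m) = balancedTmul R N M (MulOpposite.op a • n) m :=
  ((Submodule.Quotient.eq (balancedSubmodule R N M)).2
    (Submodule.subset_span ⟨n, a, m, rfl⟩)).symm

theorem balancedTmul_add (N : ModuleCat.{u} Aᵐᵒᵖ) (M : ModuleCat.{u} A) (n : N) (m m' : M) :
    balancedTmul R N M n (m + m') = balancedTmul R N M n m + balancedTmul R N M n m' :=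
  congrArg (Submodule.Quotient.mk (p := balancedSubmodule R N M)) (TensorProduct.tmul_add n m m')

theorem add_balancedTmul (N : ModuleCat.{u} Aᵐᵒᵖ) (M : ModuleCat.{u} A) (n n' : N) (m : M) :
    balancedTmul R N M (n + n') m = balancedTmul R N M n m + balancedTmul R N M n' m :=
  congrArg (Submodule.Quotient.mk (p := balancedSubmodule R N M)) (TensorProduct.add_tmul n n' m)

theorem balancedTmul_zero (N : ModuleCat.{u} Aᵐᵒᵖ) (M : ModuleCat.{u} A) (n : N) :
    balancedTmul R N M n 0 = 0 :=
  congrArg (Submodule.Quotient.mk (p := balancedSubmodule R N M)) (TensorProduct.tmul_zero _ n)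

theorem zero_balancedTmul (N : ModuleCat.{u} Aᵐᵒᵖ) (M : ModuleCat.{u} A) (m : M) :
    balancedTmul R N M 0 m = 0 :=
  congrArg (Submodule.Quotient.mk (p := balancedSubmodule R N M)) (TensorProduct.zero_tmul _ m)

/-- Scalars move across the tensor sign, leaving basis vectors on the right. Uniqueness of w is not
needed here. -/
theorem exists_eq_sum_of_free (N : ModuleCat.{u} Aᵐᵒᵖ) {ι : Type u}
    (t : BalancedTensor R N (ModuleCat.of A (ι →₀ A))) :
    ∃ w : ι →₀ N, t = w.sum fun i n =>
      balancedTmul R N (ModuleCat.of A (ι →₀ A)) n (Finsupp.single i (1 : A)) := by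
  classical
  have add : ∀ w w' : ι →₀ N, (w + w').sum (fun i n =>
      balancedTmul R N (ModuleCat.of A (ι →₀ A)) n (Finsupp.single i (1 : A))) = _ :=
    fun w w' => Finsupp.sum_add_index' (fun _ => zero_balancedTmul R _ _ _)
      (fun _ _ _ => add_balancedTmul R _ _ _ _ _)
  obtain ⟨t, rfl⟩ := Submodule.Quotient.mk_surjective _ t
  induction t using TensorProduct.induction_on with
  | zero => exact ⟨0, by rw [Finsupp.sum_zero_index]; rfl⟩
  | tmul n m =>
    change ∃ w : ι →₀ N, balancedTmul R N (ModuleCat.of A (ι →₀ A)) n m = _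
    revert m
    change ∀ m : ι →₀ A, _
    intro m
    induction m using Finsupp.induction_linear with
    | zero => exact ⟨0, by rw [Finsupp.sum_zero_index]; exact balancedTmul_zero R _ _ n⟩
    | add m m' ih ih' =>
      obtain ⟨w, hw⟩ := ih
      obtain ⟨w', hw'⟩ := ih'
      refine ⟨w + w', ?_⟩
      rw [add, ← hw, ← hw']
      exact balancedTmul_add R N _ n _ _
    | single i a =>
      refine ⟨Finsupp.single i (MulOpposite.op a • n), ?_⟩
      refine Eq.trans ?_ (Finsupp.sum_single_index
        (h := fun i n => balancedTmul R N (ModuleCat.of A (ι →₀ A)) n (Finsupp.single i (1 : A)))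
        (zero_balancedTmul R _ _ _)).symm
      rw [← balancedTmul_smul]
      congr 1
      exact (by simp : Finsupp.single i a = a • Finsupp.single i (1 : A))
  | add t t' ih ih' =>
    obtain ⟨w, hw⟩ := ih
    obtain ⟨w', hw'⟩ := ih'
    refine ⟨w + w', ?_⟩
    rw [add, ← hw, ← hw']
    rfl

theorem omegaEval_single {L : ModuleCat.{u} A} {d : ℕ} {ι : Type u} (i : ι) (ω : Omega L d) :
    omegaEval (M := ModuleCat.of A (ι →₀ A)) ω (Finsupp.single i (1 : A)) =
      Ext.comp (show Ext.{u} L (ModuleCat.of A A) d from ω)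
        (Ext.mk₀ (ModuleCat.ofHom (Finsupp.lsingle i))) (add_zero d) := by
  rw [omegaEval]
  congr 2
  ext : 1
  refine LinearMap.ext_ring ?_
  exact one_smul A (Finsupp.single i (1 : A))

theorem omegaEval_single_comp {L : ModuleCat.{u} A} {d : ℕ} {ι : Type u} [DecidableEq ι] (i j : ι)
    (ω : Omega L d) :
    (omegaEval (M := ModuleCat.of A (ι →₀ A)) ω (Finsupp.single i (1 : A))).comp
      (Ext.mk₀ (ModuleCat.ofHom (Finsupp.lapply (R := A) (M := A) j))) (add_zero d) =
      if i = j then (show Ext.{u} L (ModuleCat.of A A) d from ω) else 0 := by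
  rw [omegaEval_single, Ext.comp_assoc_of_third_deg_zero, Ext.mk₀_comp_mk₀]
  split_ifs with hij
  · subst hij
    have : ModuleCat.ofHom (Finsupp.lsingle i) ≫
        ModuleCat.ofHom (Finsupp.lapply (R := A) (M := A) i) = 𝟙 _ := by
      ext; simp
    rw [this, Ext.comp_mk₀_id]
  · have : ModuleCat.ofHom (Finsupp.lsingle i) ≫
        ModuleCat.ofHom (Finsupp.lapply (R := A) (M := A) j) = 0 := by
      ext; simp [hij]
    rw [this, Ext.mk₀_zero, Ext.comp_zero]

/-- The coordinate projections recover the coefficients of a tensor from its image, giving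
injectivity; surjectivity is the decomposition of a class into finitely many coordinates. -/
theorem ExtFinitary.comparison_free_bijective {L : ModuleCat.{u} A} (hL : ExtFinitary L) (d : ℕ)
    (ι : Type u) : Function.Bijective (comparison R L d (ModuleCat.of A (ι →₀ A))) := by
  classical
  constructor
  · rw [injective_iff_map_eq_zero]
    intro t ht
    obtain ⟨w, rfl⟩ := exists_eq_sum_of_free R (Omega L d) t
    have h₀ : w = 0 := by
      ext j
      have h₁ := congrArg ((Ext.mk₀ (ModuleCat.ofHom (Finsupp.lapply (R := A) (M := A) j))).postcomp
        L (add_zero d)) ht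
      rw [Finsupp.sum, map_sum, map_sum, map_zero] at h₁
      replace h₁ := (Finset.sum_congr rfl
        fun i _ => omegaEval_single_comp i j (w i)).symm.trans h₁
      rw [Finset.sum_ite_eq' w.support j] at h₁
      split_ifs at h₁ with hj
      · exact h₁
      · exact Finsupp.notMem_support_iff.1 hj
    rw [h₀, Finsupp.sum_zero_index]
  · intro x
    obtain ⟨s, hs⟩ := hL.exists_eq_sum x
    refine ⟨∑ j ∈ s, balancedTmul R (Omega L d) (ModuleCat.of A (ι →₀ A))
      (x.comp (Ext.mk₀ (ModuleCat.ofHom (Finsupp.lapply j))) (add_zero d))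
      (Finsupp.single j (1 : A)), ?_⟩
    conv_rhs => rw [hs]
    rw [map_sum]
    refine Finset.sum_congr rfl fun j _ => ?_
    exact (comparison_tmul R L d _ _).trans (omegaEval_single j _)

/-- A diagram chase on a free cover F → M with kernel M'. Since Ext^{d+1}(L, M') = 0, surjectivity
passes from F to M. It therefore also holds for M', and this with injectivity for F gives
injectivity for M. -/
theorem ExtFinitary.comparison_bijective {L : ModuleCat.{u} A} (hL : ExtFinitary L) {d : ℕ}
    (hd : ∀ M : ModuleCat.{u} A, Subsingleton (Ext.{u} L M (d + 1))) (M : ModuleCat.{u} A) :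
    Function.Bijective (comparison R L d M) := by
  have surj : ∀ M : ModuleCat.{u} A, Function.Surjective (comparison R L d M) := by
    intro M x
    have hS := (Finsupp.linearCombination A (id : M → M)).shortExact_shortComplexKer
      (Finsupp.linearCombination_id_surjective A M)
    obtain ⟨y, hy⟩ := Ext.covariant_sequence_exact₃ L hS x rfl
      (@Subsingleton.elim _ (hd _) _ _)
    obtain ⟨t, rfl⟩ := (hL.comparison_free_bijective R d M).2 y
    exact ⟨_, (comparison_balancedMap R L d _ t).trans hy⟩
  refine ⟨?_, surj M⟩
  rw [injective_iff_map_eq_zero]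
  intro t ht
  have hp := Finsupp.linearCombination_id_surjective A M
  have hS := (Finsupp.linearCombination A (id : M → M)).shortExact_shortComplexKer hp
  obtain ⟨t, rfl⟩ := balancedMap_surjective R (Omega L d)
    (ModuleCat.ofHom (Finsupp.linearCombination A (id : M → M))) hp t
  rw [comparison_balancedMap] at ht
  obtain ⟨x, hx⟩ := Ext.covariant_sequence_exact₂ L hS _ ht
  obtain ⟨z, rfl⟩ := surj _ x
  have hz := (hL.comparison_free_bijective R d M).1
    ((comparison_balancedMap R L d _ z).trans hx)
  rw [← hz]
  refine (balancedMap_comp_apply R _ _ _ z).trans ?_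
  refine (congrArg (fun f => balancedMap R (Omega L d) f z)
    (ShortComplex.zero _)).trans (balancedMap_zero_apply R _ z)

end Comparison

/-! ### Syzygies of a projective resolution -/

section Syzygies

variable {A : Type u} [Ring A] {M : ModuleCat.{u} A} (Q : ProjectiveResolution M)

/-- The syzygies of a projective resolution of `M`, starting with `M` itself. -/
def syzygy : ℕ → ModuleCat.{u} A
  | 0 => M
  | j + 1 => ModuleCat.of A (LinearMap.range (Q.complex.d (j + 1) j).hom)

/-- The inclusion of the `(j + 1)`-st syzygy. -/
def syzygyι (j : ℕ) : syzygy Q (j + 1) ⟶ Q.complex.X j :=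
  ModuleCat.ofHom (LinearMap.range (Q.complex.d (j + 1) j).hom).subtype

/-- The projection to the `j`-th syzygy. -/
def syzygyπ : ∀ j : ℕ, Q.complex.X j ⟶ syzygy Q j
  | 0 => Q.π.f 0
  | j + 1 => ModuleCat.ofHom (Q.complex.d (j + 1) j).hom.rangeRestrict

theorem range_syzygyι (j : ℕ) :
    LinearMap.range (syzygyι Q j).hom = LinearMap.range (Q.complex.d (j + 1) j).hom :=
  Submodule.range_subtype _

theorem range_syzygyι_eq_ker (j : ℕ) :
    LinearMap.range (syzygyι Q j).hom = LinearMap.ker (syzygyπ Q j).hom := by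
  rw [range_syzygyι]
  cases j with
  | zero => exact Q.exact₀.moduleCat_range_eq_ker
  | succ j =>
    exact (Q.exact_succ j).moduleCat_range_eq_ker.trans
      (LinearMap.ker_rangeRestrict (Q.complex.d (j + 1) j).hom).symm

theorem syzygyπ_surjective (j : ℕ) : Function.Surjective (syzygyπ Q j).hom := by
  cases j with
  | zero => exact (ModuleCat.epi_iff_surjective _).1 (inferInstance : Epi (Q.π.f 0))
  | succ j => exact LinearMap.surjective_rangeRestrict _

/-- The short exact sequence of consecutive syzygies. -/
def syzygyComplex (j : ℕ) : ShortComplex (ModuleCat.{u} A) where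
  X₁ := syzygy Q (j + 1)
  X₂ := Q.complex.X j
  X₃ := syzygy Q j
  f := syzygyι Q j
  g := syzygyπ Q j
  zero := by
    ext x
    have : (syzygyι Q j).hom x ∈ LinearMap.ker (syzygyπ Q j).hom :=
      range_syzygyι_eq_ker Q j ▸ ⟨x, rfl⟩
    exact this

theorem syzygyComplex_shortExact (j : ℕ) : (syzygyComplex Q j).ShortExact :=
  ModuleCat.shortComplex_shortExact _
    (LinearMap.exact_iff.2 (range_syzygyι_eq_ker Q j).symm)
    (Submodule.injective_subtype _) (syzygyπ_surjective Q j)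

end Syzygies

/-! ### Homology as a kernel on a cokernel -/

section Homology

variable {R : Type u} [CommRing R]

/-- U is the cokernel of `S.f`, and v is the map induced on it by `S.g`, up to the injection e;
cycles modulo boundaries form its kernel. -/
theorem nonempty_homology_equiv_ker (S : ShortComplex (ModuleCat.{u} R)) {U V : Type u}
    [AddCommGroup U] [Module R U] [AddCommGroup V] [Module R V] (p : S.X₂ →ₗ[R] U)
    (hp : Function.Surjective p) (hker : LinearMap.ker p = LinearMap.range S.f.hom)
    (v : U →ₗ[R] V) (e : S.X₃ →ₗ[R] V) (he : Function.Injective e)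
    (hv : ∀ x, v (p x) = e (S.g.hom x)) :
    Nonempty (S.homology ≃ₗ[R] LinearMap.ker v) := by
  let q : LinearMap.ker S.g.hom →ₗ[R] LinearMap.ker v :=
    p.restrict fun x hx => by rw [LinearMap.mem_ker, hv, LinearMap.mem_ker.1 hx, map_zero]
  have hq : Function.Surjective q := by
    rintro ⟨y, hy⟩
    obtain ⟨x, rfl⟩ := hp y
    rw [LinearMap.mem_ker, hv] at hy
    exact ⟨⟨x, he (hy.trans (map_zero e).symm)⟩, rfl⟩
  have hk : LinearMap.range S.moduleCatToCycles = LinearMap.ker q := by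
    ext ⟨x, hx⟩
    have h₁ : x ∈ LinearMap.ker p ↔ x ∈ LinearMap.range S.f.hom := by rw [hker]
    rw [LinearMap.mem_ker, Subtype.ext_iff]
    refine Iff.trans ?_ h₁.symm
    exact ⟨fun ⟨y, hy⟩ => ⟨y, congrArg Subtype.val hy⟩, fun ⟨y, hy⟩ => ⟨y, Subtype.ext hy⟩⟩
  exact ⟨S.moduleCatHomologyIso.toLinearEquiv ≪≫ₗ
    (Submodule.quotEquivOfEq _ _ hk ≪≫ₗ q.quotKerEquivOfSurjective hq)⟩

end Homology

/-! ### Tor and Ext along the resolution of M -/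

section Derived

open Abelian

attribute [local instance] moduleOfAlgebra isScalarTower_of_algebra smulCommClass_of_algebra

variable (R : Type u) [CommRing R] {A : Type u} [Ring A] [Algebra R A]

/-- Middle exactness is transported from the long exact Ext sequence through the comparison
isomorphisms. -/
theorem ker_balancedMap {L : ModuleCat.{u} A} {d : ℕ}
    (hc : ∀ M : ModuleCat.{u} A, Function.Bijective (comparison R L d M))
    {S : ShortComplex (ModuleCat.{u} A)} (hS : S.ShortExact) :
    LinearMap.ker (balancedMap R (Omega L d) S.g) =
      LinearMap.range (balancedMap R (Omega L d) S.f) := by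
  ext t
  constructor
  · intro ht
    have h₁ := comparison_balancedMap R L d S.g t
    rw [LinearMap.mem_ker.1 ht, map_zero] at h₁
    obtain ⟨x, hx⟩ := Ext.covariant_sequence_exact₂ L hS _ h₁.symm
    obtain ⟨s, rfl⟩ := (hc _).2 x
    exact ⟨s, (hc _).1 ((comparison_balancedMap R L d S.f s).trans hx)⟩
  · rintro ⟨s, rfl⟩
    rw [LinearMap.mem_ker, balancedMap_comp_apply, S.zero, balancedMap_zero_apply]

theorem ker_balancedMap_syzygyπ {L : ModuleCat.{u} A} {d : ℕ}
    (hc : ∀ M : ModuleCat.{u} A, Function.Bijective (comparison R L d M))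
    {M : ModuleCat.{u} A} (Q : ProjectiveResolution M) (j : ℕ) :
    LinearMap.ker (balancedMap R (Omega L d) (syzygyπ Q j)) =
      LinearMap.range (balancedMap R (Omega L d) (Q.complex.d (j + 1) j)) := by
  refine (ker_balancedMap R hc (syzygyComplex_shortExact Q j)).trans (le_antisymm ?_ ?_)
  · rintro _ ⟨t, rfl⟩
    obtain ⟨s, rfl⟩ := balancedMap_surjective R (Omega L d) _ (syzygyπ_surjective Q (j + 1)) t
    exact ⟨s, (balancedMap_comp_apply R _ (syzygyπ Q (j + 1)) (syzygyι Q j) s).symm⟩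
  · rintro _ ⟨s, rfl⟩
    exact ⟨_, balancedMap_comp_apply R _ (syzygyπ Q (j + 1)) (syzygyι Q j) s⟩

/-- `Tor_{j+1}(Ω, M)` is the kernel of `Ω ⊗ B_{j+1} → Ω ⊗ Q_j`. -/
theorem nonempty_leftDerived_succ_equiv {L : ModuleCat.{u} A} {d : ℕ}
    (hc : ∀ M : ModuleCat.{u} A, Function.Bijective (comparison R L d M))
    {M : ModuleCat.{u} A} (Q : ProjectiveResolution M) (j : ℕ) :
    Nonempty ((((tensorFunctor R (Omega L d)).leftDerived (j + 1)).obj M) ≃ₗ[R]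
      LinearMap.ker (balancedMap R (Omega L d) (syzygyι Q j))) := by
  let K := ((tensorFunctor R (Omega L d)).mapHomologicalComplex (ComplexShape.down ℕ)).obj Q.complex
  let e₁ := Q.isoLeftDerivedObj (tensorFunctor R (Omega L d)) (j + 1)
  let e₂ := ShortComplex.homologyMapIso (K.isoSc' (j + 2) (j + 1) j (by simp) (by simp))
  obtain ⟨e₃⟩ := nonempty_homology_equiv_ker (K.sc' (j + 2) (j + 1) j)
    (balancedMap R (Omega L d) (syzygyπ Q (j + 1)))
    (balancedMap_surjective R _ _ (syzygyπ_surjective Q (j + 1)))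
    (ker_balancedMap_syzygyπ R hc Q (j + 1))
    (balancedMap R (Omega L d) (syzygyι Q j)) LinearMap.id Function.injective_id
    (fun x => balancedMap_comp_apply R _ _ _ x)
  exact ⟨(e₁ ≪≫ e₂).toLinearEquiv ≪≫ₗ e₃⟩

theorem nonempty_leftDerived_zero_equiv {L : ModuleCat.{u} A} {d : ℕ}
    (hc : ∀ M : ModuleCat.{u} A, Function.Bijective (comparison R L d M))
    (M : ModuleCat.{u} A) :
    Nonempty ((((tensorFunctor R (Omega L d)).leftDerived 0).obj M) ≃ₗ[R]
      BalancedTensor R (Omega L d) M) := by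
  let Q := projectiveResolution M
  let K := ((tensorFunctor R (Omega L d)).mapHomologicalComplex (ComplexShape.down ℕ)).obj Q.complex
  let e₁ := Q.isoLeftDerivedObj (tensorFunctor R (Omega L d)) 0
  let e₂ := ShortComplex.homologyMapIso (K.isoSc' 1 0 0 (by simp) (by simp))
  obtain ⟨e₃⟩ := nonempty_homology_equiv_ker (K.sc' 1 0 0)
    (balancedMap R (Omega L d) (syzygyπ Q 0))
    (balancedMap_surjective R _ _ (syzygyπ_surjective Q 0))
    (ker_balancedMap_syzygyπ R hc Q 0)
    -- In degree 0 the outgoing map is the self-loop `K.d 0 0`, which vanishes, so the kernel is all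
    -- of Ω ⊗ M.
    (0 : BalancedTensor R (Omega L d) M →ₗ[R] K.X 0) LinearMap.id Function.injective_id
    (fun x => congr($(K.shape 0 0 (by simp)) x).symm)
  exact ⟨(e₁ ≪≫ e₂).toLinearEquiv ≪≫ₗ e₃ ≪≫ₗ LinearEquiv.ofTop _ LinearMap.ker_zero⟩

/-- If `Ext^n(L, X₂) = 0`, the connecting homomorphism identifies `Ext^n(L, X₃)` with the kernel of
`Ext^{n+1}(L, X₁) → Ext^{n+1}(L, X₂)`. -/
theorem nonempty_ext_equiv_ker {L : ModuleCat.{u} A} {S : ShortComplex (ModuleCat.{u} A)}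
    (hS : S.ShortExact) (n : ℕ) (h₂ : Subsingleton (Ext.{u} L S.X₂ n)) :
    Nonempty (Ext.{u} L S.X₃ n ≃ₗ[R]
      LinearMap.ker ((Ext.mk₀ S.f).postcompOfLinear R L (add_zero (n + 1)))) := by
  let δ : Ext.{u} L S.X₃ n →ₗ[R] Ext.{u} L S.X₁ (n + 1) := hS.extClass.postcompOfLinear R L rfl
  have hδ : Function.Injective δ := by
    rw [injective_iff_map_eq_zero]
    intro x hx
    obtain ⟨y, rfl⟩ := Ext.covariant_sequence_exact₃ L hS x rfl hx
    rw [Subsingleton.elim y 0, Ext.zero_comp]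
  have hr : LinearMap.range δ = LinearMap.ker ((Ext.mk₀ S.f).postcompOfLinear R L
      (add_zero (n + 1))) := by
    ext x
    constructor
    · rintro ⟨y, rfl⟩
      change (Ext.comp y hS.extClass rfl).comp (Ext.mk₀ S.f) (add_zero (n + 1)) = 0
      rw [Ext.comp_assoc_of_third_deg_zero, hS.extClass_comp, Ext.comp_zero]
    · intro hx
      obtain ⟨y, hy⟩ := Ext.covariant_sequence_exact₁ L hS x hx rfl
      exact ⟨y, hy⟩
  exact ⟨LinearEquiv.ofInjective δ hδ ≪≫ₗ LinearEquiv.ofEq _ _ hr⟩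

/-- Each connecting map is bijective as long as its target degree stays below d, because Ext of the
projective term then vanishes in both degrees. -/
theorem nonempty_ext_equiv_ext_syzygy {L M : ModuleCat.{u} A} (Q : ProjectiveResolution M) {d : ℕ}
    (hP : ∀ i < d, ∀ P : ModuleCat.{u} A, Projective P → Subsingleton (Ext.{u} L P i))
    (n s : ℕ) (hns : n + s < d) (t : ℕ) :
    Nonempty (Ext.{u} L (syzygy Q t) n ≃ₗ[R] Ext.{u} L (syzygy Q (t + s)) (n + s)) := by
  induction s with
  | zero => exact ⟨LinearEquiv.refl _ _⟩
  | succ s ih =>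
    obtain ⟨e⟩ := ih (by omega)
    obtain ⟨e'⟩ := nonempty_ext_equiv_ker R (L := L) (syzygyComplex_shortExact Q (t + s)) (n + s)
      (hP (n + s) (by omega) _ (Q.projective _))
    have : Subsingleton (Ext.{u} L (syzygyComplex Q (t + s)).X₂ (n + s + 1)) :=
      hP _ (by omega) _ (Q.projective _)
    have htop : LinearMap.ker ((Ext.mk₀ (syzygyComplex Q (t + s)).f).postcompOfLinear R L
      (add_zero (n + s + 1))) = ⊤ :=
      LinearMap.ker_eq_top.2 (LinearMap.ext fun _ => Subsingleton.elim _ _)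
    exact ⟨e ≪≫ₗ e' ≪≫ₗ LinearEquiv.ofTop _ htop⟩

theorem nonempty_ker_equiv_ker {L : ModuleCat.{u} A} {d : ℕ}
    (hc : ∀ M : ModuleCat.{u} A, Function.Bijective (comparison R L d M))
    {M M' : ModuleCat.{u} A} (f : M ⟶ M') :
    Nonempty (LinearMap.ker (balancedMap R (Omega L d) f) ≃ₗ[R]
      LinearMap.ker ((Ext.mk₀ f).postcompOfLinear R L (add_zero d))) := by
  refine ⟨(LinearEquiv.ofBijective _ (hc M)).ofSubmodules _ _ ?_⟩
  ext x
  obtain ⟨t, rfl⟩ := (hc M).2 x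
  have h₁ := comparison_balancedMap R L d f t
  constructor
  · rintro ⟨s, hs, hst⟩
    obtain rfl := (hc M).1 hst
    rw [LinearMap.mem_ker.1 hs, map_zero] at h₁
    exact h₁.symm
  · intro ht
    exact ⟨t, (hc M').1 ((h₁.trans ht).trans (map_zero _).symm), rfl⟩

theorem nonempty_ext_equiv_leftDerived {L : ModuleCat.{u} A} {d : ℕ}
    (hc : ∀ M : ModuleCat.{u} A, Function.Bijective (comparison R L d M))
    (hP : ∀ i < d, ∀ P : ModuleCat.{u} A, Projective P → Subsingleton (Ext.{u} L P i))
    (M : ModuleCat.{u} A) (n j : ℕ) (hnj : n + j = d) :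
    Nonempty (Ext.{u} L M n ≃ₗ[R] (((tensorFunctor R (Omega L d)).leftDerived j).obj M)) := by
  cases j with
  | zero =>
    obtain rfl : n = d := hnj
    obtain ⟨e⟩ := nonempty_leftDerived_zero_equiv R hc M
    exact ⟨(e ≪≫ₗ LinearEquiv.ofBijective _ (hc M)).symm⟩
  | succ j =>
    obtain rfl : d = n + j + 1 := hnj.symm
    let Q := projectiveResolution M
    obtain ⟨e₁⟩ := nonempty_leftDerived_succ_equiv R hc Q j
    obtain ⟨e₂⟩ := nonempty_ker_equiv_ker R hc (syzygyι Q j)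
    -- The last shift lands in degree d, where Ext of the projective term may survive; this is why a
    -- kernel appears, matching the one for Tor.
    obtain ⟨e₃⟩ := nonempty_ext_equiv_ker R (L := L) (syzygyComplex_shortExact Q j) (n + j)
      (hP (n + j) (by omega) _ (Q.projective _))
    obtain ⟨e₄⟩ := nonempty_ext_equiv_ext_syzygy R Q hP n j (by omega) 0
    rw [zero_add] at e₄
    exact ⟨e₄ ≪≫ₗ e₃ ≪≫ₗ (e₁ ≪≫ₗ e₂).symm⟩

/-- Tor_j is again a kernel on Ext^d. For d = 0 it vanishes by left exactness of Hom. For d > 0,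
shifting down to degree 0 gives Hom from L to a syzygy of positive index, which embeds in Hom(L,
Q_m) = 0. -/
theorem subsingleton_leftDerived {L : ModuleCat.{u} A} {d : ℕ}
    (hc : ∀ M : ModuleCat.{u} A, Function.Bijective (comparison R L d M))
    (hP : ∀ i < d, ∀ P : ModuleCat.{u} A, Projective P → Subsingleton (Ext.{u} L P i))
    (M : ModuleCat.{u} A) (j : ℕ) (hj : d < j) :
    Subsingleton (((tensorFunctor R (Omega L d)).leftDerived j).obj M) := by
  obtain ⟨j, rfl⟩ : ∃ m, j = m + 1 := ⟨j - 1, by omega⟩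
  let Q := projectiveResolution M
  obtain ⟨e₁⟩ := nonempty_leftDerived_succ_equiv R hc Q j
  obtain ⟨e₂⟩ := nonempty_ker_equiv_ker R hc (syzygyι Q j)
  refine (e₁ ≪≫ₗ e₂).toEquiv.subsingleton_congr.2 ?_
  have mono : ∀ j, Mono (syzygyι Q j) := fun j =>
    (ModuleCat.mono_iff_injective _).2 (Submodule.injective_subtype _)
  cases d with
  | zero =>
    rw [Submodule.subsingleton_iff_eq_bot, LinearMap.ker_eq_bot]
    have := mono j
    exact Ext.postcomp_mk₀_injective_of_mono L (syzygyι Q j)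
  | succ d =>
    obtain ⟨e₃⟩ := nonempty_ext_equiv_ker R (L := L) (syzygyComplex_shortExact Q j) d
      (hP (d) (by omega) _ (Q.projective _))
    refine e₃.symm.toEquiv.subsingleton_congr.2 ?_
    obtain ⟨m, rfl⟩ : ∃ m, j = m + 1 + d := ⟨j - 1 - d, by omega⟩
    obtain ⟨e₄⟩ := nonempty_ext_equiv_ext_syzygy R Q hP 0 d (by omega) (m + 1)
    rw [zero_add] at e₄
    refine e₄.symm.toEquiv.subsingleton_congr.2 ?_
    have := mono m
    have := hP 0 (by omega) (Q.complex.X m) (Q.projective _)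
    exact (Ext.postcomp_mk₀_injective_of_mono L (syzygyι Q m)).subsingleton

end Derived

/-! ### The module K over A, and the theorem -/

section Main

open Abelian

theorem isReduction_constantCoeff {k A₀ A : Type u} [Field k] [Ring A₀] [Algebra k A₀]
    [Ring A] [Algebra k⟦X⟧ A] (D : Deformation k A₀ A) [Module A₀ k] [Module A k⟦X⟧]
    [IsScalarTower k⟦X⟧ A k⟦X⟧]
    (hred : ∀ (a : A) (f : k⟦X⟧),
      PowerSeries.constantCoeff (a • f) = D.red a • PowerSeries.constantCoeff f) :
    IsReduction (algebraMap k⟦X⟧ A PowerSeries.X)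
      ({ toFun := PowerSeries.constantCoeff, map_add' := map_add _, map_smul' := hred } :
        k⟦X⟧ →ₛₗ[D.red] k) where
  surjective c := ⟨PowerSeries.C c, PowerSeries.constantCoeff_C c⟩
  eq_zero_iff f := by
    simp only [algebraMap_smul, smul_eq_mul]
    exact PowerSeries.X_dvd_iff.symm

theorem isTorsionFreeAt_powerSeries (k A : Type u) [Field k] [Ring A] [Algebra k⟦X⟧ A]
    [Module A k⟦X⟧] [IsScalarTower k⟦X⟧ A k⟦X⟧] :
    IsTorsionFreeAt (algebraMap k⟦X⟧ A PowerSeries.X) k⟦X⟧ := fun f hf => by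
  rw [algebraMap_smul, smul_eq_mul] at hf
  exact (mul_eq_zero.1 hf).resolve_left PowerSeries.X_ne_zero

theorem finite_powerSeries (k A : Type u) [Field k] [Ring A] [Algebra k⟦X⟧ A]
    [Module A k⟦X⟧] [IsScalarTower k⟦X⟧ A k⟦X⟧] : Module.Finite A k⟦X⟧ :=
  ⟨⟨{1}, eq_top_iff.2 fun f _ => by
    rw [Finset.coe_singleton, Submodule.mem_span_singleton]
    exact ⟨algebraMap k⟦X⟧ A f, by rw [algebraMap_smul, smul_eq_mul, mul_one]⟩⟩⟩

end Main

end QuantumDuality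
end

theorem mainTheorem2 (k : Type u) [Field k] [CharZero k]
    (A₀ : Type u) [Ring A₀] [Algebra k A₀] [IsNoetherianRing A₀]
    (A : Type u) [Ring A] [Algebra k⟦X⟧ A] (D : QuantumDuality.Deformation k A₀ A)
    [Module A₀ k] [IsScalarTower k A₀ k] (d : ℕ)
    (hExt : ∀ i : ℕ, i ≠ d →
      Subsingleton (Abelian.Ext.{u} (ModuleCat.of A₀ k) (ModuleCat.of A₀ A₀) i))
    (hExt_d : Nonempty
      (Abelian.Ext.{u} (ModuleCat.of A₀ k) (ModuleCat.of A₀ A₀) d ≃ₗ[k] k))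
    [Module A k⟦X⟧] [IsScalarTower k⟦X⟧ A k⟦X⟧]
    (hred : ∀ (a : A) (f : k⟦X⟧),
      PowerSeries.constantCoeff (a • f) = D.red a • PowerSeries.constantCoeff f)
    (hpd : ∃ n : ℕ, HasProjectiveDimensionLE (ModuleCat.of A k⟦X⟧) n)
    (M : ModuleCat.{u} A) (i : ℤ) :
    Nonempty (QuantumDuality.ExtInt k⟦X⟧ (ModuleCat.of A k⟦X⟧) M i ≃ₗ[k⟦X⟧]
      QuantumDuality.TorInt k⟦X⟧ (QuantumDuality.Omega (ModuleCat.of A k⟦X⟧) d) M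
        ((d : ℤ) - i)) := by
  have hh := D.isFormalParameter
  have hk : ∀ a, D.red a = 0 ↔ ∃ b, a = algebraMap k⟦X⟧ A PowerSeries.X * b := fun a => by
    simp only [D.red_eq_zero_iff, Algebra.smul_def]
  have hL := QuantumDuality.isTorsionFreeAt_powerSeries k A
  have := QuantumDuality.finite_powerSeries k A
  have hfin : QuantumDuality.ExtFinitary (ModuleCat.of A k⟦X⟧) := fun i _ x =>
    hh.exists_finset_comp_finsuppRestrict D.red_surjective hk i hL x
  have hvan : ∀ i, i ≠ d →
      Subsingleton (Abelian.Ext.{u} (ModuleCat.of A k⟦X⟧) (ModuleCat.of A A) i) := fun i hi =>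
    hh.subsingleton_ext_of_reduction D.red_surjective hk i hL
      (QuantumDuality.isReduction_constantCoeff D hred) (hExt i hi)
  obtain ⟨n, hn⟩ := hpd
  have hgt : ∀ i, d < i → ∀ M : ModuleCat.{u} A,
      Subsingleton (Abelian.Ext.{u} (ModuleCat.of A k⟦X⟧) M i) := fun i hi M =>
    hfin.subsingleton_of_lt (n := n + 1) (fun i hi => hvan i hi.ne') hi M
  have hc := hfin.comparison_bijective k⟦X⟧ (d := d) (hgt _ (Nat.lt_succ_self d))
  have hP : ∀ i < d, ∀ P : ModuleCat.{u} A, Projective P →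
      Subsingleton (Abelian.Ext.{u} (ModuleCat.of A k⟦X⟧) P i) := fun i hi P _ =>
    hfin.subsingleton_of_projective (hvan i hi.ne) P
  have zero_equiv : ∀ U V : ModuleCat.{u} k⟦X⟧, Subsingleton U → Subsingleton V →
      Nonempty (U ≃ₗ[k⟦X⟧] V) := fun U V _ _ => ⟨0⟩
  cases i with
  -- For 0 ≤ i ≤ d the dimension shift applies. For i > d the Tor index is negative and Ext
  -- vanishes; for i < 0 the index exceeds d and Tor vanishes.
  | ofNat n =>
    by_cases hnd : n ≤ d
    · obtain ⟨j, rfl⟩ := Nat.exists_eq_add_of_le hnd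
      rw [show ((n + j : ℕ) : ℤ) - Int.ofNat n = Int.ofNat j by simp]
      exact QuantumDuality.nonempty_ext_equiv_leftDerived k⟦X⟧ hc hP M n j rfl
    · push Not at hnd
      obtain ⟨j, rfl⟩ := Nat.exists_eq_add_of_lt hnd
      rw [show (d : ℤ) - Int.ofNat (d + j + 1) = Int.negSucc j by
        rw [Int.negSucc_eq]; simp; ring]
      exact zero_equiv _ _ (hgt _ hnd M) (inferInstanceAs (Subsingleton PUnit))
  | negSucc n =>
    rw [show (d : ℤ) - Int.negSucc n = Int.ofNat (d + n + 1) by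
      rw [Int.negSucc_eq]; simp; ring]
    exact zero_equiv _ _ (inferInstanceAs (Subsingleton PUnit))
      (QuantumDuality.subsingleton_leftDerived k⟦X⟧ hc hP M _ (by omega))
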